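/- A finite attributed graph is $g=(V,E,\mathrm{at})$ with $V$ a finite set of positive integers, $E\subseteq V\times V$ a set of directed edges without self-loops, and $\mathrm{at}:V\cup E\to\mathbb R$ with $\mathrm{at}(e)\neq 0$ for every edge $e\in E$ (node attributes may be $0$). Two such graphs are isomorphic if some bijection of their node sets preserves and reflects edges and preserves all attributes. The matrix $A_g\in\mathbb R^{V\times V}$ has entries $(A_g)_{v,v}=\mathrm{at}(v)$, $(A_g)_{u,v}=\mathrm{at}((u,v))$ if $(u,v)\in E$, and $(A_g)_{u,v}=0$ otherwise. For $k\ge 1$ let $\mathcal P_k$ be the set of all partitions of $\{1,\dots,k\}$. For $\gamma\in\mathcal P_k$ and $i\in V^k$ put $I_\gamma(i)=1$ if, for all $a,b$, $i_a=i_b$ holds exactly when $a,b$ lie in the same block of $\gamma$, and $I_\gamma(i)=0$ otherwise. A parameter is $w=(k,\theta,\theta',\eta,\eta_0)$ with an integer $k\ge1$, $\theta\in\mathbb R^{\mathcal P_{k+2}}$, $\theta'\in\mathbb R^{\mathcal P_k}$, $\eta\in\mathbb R^{\mathcal P_k}$, $\eta_0\in\mathbb R$; it does not depend on the number of nodes.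 For $A\in\mathbb R^{V\times V}$, $i\in V^k$ and $T:V^k\to\mathbb R$ put $$F_{2,k}(A)(i)=\sum_{\gamma\in\mathcal P_{k+2}}\theta_\gamma\sum_{j\in V^2}I_\gamma(i,j)\,A_{j_1,j_2}+\sum_{\gamma\in\mathcal P_k}\theta'_\gamma I_\gamma(i),\qquad H_k(T)=\sum_{\gamma\in\mathcal P_k}\eta_\gamma\sum_{i\in V^k}I_\gamma(i)\,T(i)+\eta_0 .$$ For $\rho_i,\rho_e:\mathbb R\to\mathbb R$ the graph neural feature with parameter $w$ is $\psi(g;w)=\rho_i\bigl(H_k\bigl(\rho_e(F_{2,k}(A_g))\bigr)\bigr)$, with $\rho_e$ applied componentwise. **Lemma 1.** Let $\rho_e$ be a squashing function, i.e. non-decreasing with $\lim_{x\to-\infty}\rho_e(x)=0$ and $\lim_{x\to+\infty}\rho_e(x)=1$, and let $\rho_i$ be non-constant (neither needs to be continuous). Then for any two non-isomorphic finite attributed graphs $g_1,g_2$, of possibly different orders, there is a parameter $w^*$ such that $\psi(g_1;w^*)\neq\psi(g_2;w^*)$. -/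

import Mathlib

/-- A finite attributed graph `g = (V, E, at)`: a finite set `V` of positive integers as nodes, a set
`E ⊆ V × V` of directed edges without self-loops, and a real attribute on every node and every edge.
An edge attribute is nonzero, since the entry `0` of an adjacency matrix stands for `no edge`.
Node attributes are arbitrary. -/
structure AttrGraph where
  V : Finset ℕ
  V_pos : ∀ v ∈ V, 1 ≤ v
  E : Set (V × V)
  loopless : ∀ v : V, (v, v) ∉ E
  nodeAttr : V → ℝ
  edgeAttr : E → ℝ
  edgeAttr_ne_zero : ∀ e : E, edgeAttr e ≠ 0

namespace AttrGraph

/-- The graphs with at most `n` nodes, all of them among `1, …, n`. -/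
def upTo (n : ℕ) : Set AttrGraph := {g | g.V ⊆ Finset.Icc 1 n}

/-- The graphs of arbitrarily large, yet finite, order. -/
def all : Set AttrGraph := ⋃ n : ℕ, upTo n

/-- Isomorphism of attributed graphs: a bijection of the nodes that preserves and reflects edges and
preserves the attributes of nodes and edges. -/
def Isomorphic (g₁ g₂ : AttrGraph) : Prop :=
  ∃ φ : g₁.V ≃ g₂.V,
    (∀ u v, (u, v) ∈ g₁.E ↔ (φ u, φ v) ∈ g₂.E) ∧
    (∀ v, g₁.nodeAttr v = g₂.nodeAttr (φ v)) ∧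
    (∀ u v, ∀ h₁ : (u, v) ∈ g₁.E, ∀ h₂ : (φ u, φ v) ∈ g₂.E,
      g₁.edgeAttr ⟨(u, v), h₁⟩ = g₂.edgeAttr ⟨(φ u, φ v), h₂⟩)

end AttrGraph

/-- Real tensors of order `k` all of whose modes are indexed by the finite node set `N`; for `N` of
cardinality `n` this is `ℝ^(n × ⋯ × n)`, with no ordering of the nodes chosen. -/
abbrev NodeTensor (N : Type*) (k : ℕ) : Type _ := (Fin k → N) → ℝ

open Classical in
/-- The weighted adjacency matrix of a graph: node attributes on the diagonal, edge attributes off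
the diagonal, and `0` elsewhere. Its size is the order of the graph. -/
noncomputable def AttrGraph.adj (g : AttrGraph) : NodeTensor g.V 2 := fun i =>
  if i 0 = i 1 then g.nodeAttr (i 0)
  else if h : (i 0, i 1) ∈ g.E then g.edgeAttr ⟨(i 0, i 1), h⟩
  else 0

/-- There are `Bell k` equivalence relations (i.e. partitions) on `k` points. -/
noncomputable instance setoidFinFintype (k : ℕ) : Fintype (Setoid (Fin k)) :=
  Fintype.ofInjective (fun γ : Setoid (Fin k) => {p : Fin k × Fin k | γ p.1 p.2}) (by
    intro γ δ h
    ext a b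
    exact Set.ext_iff.mp h (a, b))

open Classical in
/-- The tensor `I_γ` of order `k`: the `0`-`1` indicator of the multi-indices `i` whose equality
pattern is the partition `γ`, i.e. `i a = i b` if and only if `a` and `b` are in one block. -/
noncomputable def invTensor {N : Type*} {k : ℕ} (γ : Setoid (Fin k)) : NodeTensor N k := fun i =>
  if Setoid.ker i = γ then 1 else 0

/-- The basic linear invariant map `T ↦ I_γ T`, the full contraction of `T` with `I_γ`. -/
noncomputable def invMap {N : Type*} [Fintype N] {k : ℕ} (γ : Setoid (Fin k))
    (T : NodeTensor N k) : ℝ :=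
  ∑ i : Fin k → N, invTensor γ i * T i

/-- The basic linear equivariant map `T ↦ E_γ T` from order `l` to order `k`, where `γ` is a partition
of the `k` output modes together with the `l` input modes. -/
noncomputable def equivMap {N : Type*} [Fintype N] {l k : ℕ} (γ : Setoid (Fin (k + l)))
    (T : NodeTensor N l) : NodeTensor N k := fun i =>
  ∑ j : Fin l → N, invTensor γ (Fin.append i j) * T j

/-- The affine invariant map `H_k`. -/
noncomputable def affineInv {N : Type*} [Fintype N] {k : ℕ} (θ : Setoid (Fin k) → ℝ) (b : ℝ)
    (T : NodeTensor N k) : ℝ :=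
  ∑ γ, θ γ * invMap γ T + b

/-- The affine equivariant map `F_{l,k}`. -/
noncomputable def affineEquiv {N : Type*} [Fintype N] {l k : ℕ} (θ : Setoid (Fin (k + l)) → ℝ)
    (b : Setoid (Fin k) → ℝ) (T : NodeTensor N l) : NodeTensor N k := fun i =>
  ∑ γ, θ γ * equivMap γ T i + ∑ γ, b γ * invTensor γ i

/-- The parameters `w = (k, θ_F, θ_H)`, with `k ≥ 1`, where `θ_F` consists of `Bell (k + 2)` linear and
`Bell k` bias coefficients, and `θ_H` of `Bell k` linear coefficients and one bias. They do not
depend on the size of the graph. -/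
structure FeatureParam where
  k : ℕ
  k_pos : 1 ≤ k
  linF : Setoid (Fin (k + 2)) → ℝ
  biasF : Setoid (Fin k) → ℝ
  linH : Setoid (Fin k) → ℝ
  biasH : ℝ

/-- The composition `ρ_i ∘ H_k ∘ ρ_e ∘ F_{2,k}` on matrices indexed by a finite node set, with `ρ_e`
applied to every component. -/
noncomputable def tensorFeature (ρi ρe : ℝ → ℝ) (w : FeatureParam) {N : Type*} [Fintype N]
    (A : NodeTensor N 2) : ℝ :=
  ρi (affineInv w.linH w.biasH fun i => ρe (affineEquiv w.linF w.biasF A i))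

/-- The graph neural feature `ψ(g; w)`. -/
noncomputable def graphFeature (ρi ρe : ℝ → ℝ) (w : FeatureParam) (g : AttrGraph) : ℝ :=
  tensorFeature ρi ρe w g.adj

/-- The value of a feature does not depend on the labelling of the nodes. In particular it can be
computed from the adjacency matrix with rows and columns in any ordering `Fin n ≃ N`. -/
theorem tensorFeature_relabel (ρi ρe : ℝ → ℝ) (w : FeatureParam) {M N : Type*} [Fintype M]
    [Fintype N] (e : M ≃ N) (A : NodeTensor N 2) :
    tensorFeature ρi ρe w (fun i : Fin 2 → M => A (e ∘ i)) = tensorFeature ρi ρe w A := by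
  have hker : ∀ {k : ℕ} (γ : Setoid (Fin k)) (i : Fin k → M),
      invTensor γ (e ∘ i) = invTensor γ i := by
    intro k γ i
    have : Setoid.ker (e ∘ i) = Setoid.ker i := by
      ext a b
      simp [Setoid.ker_def]
    unfold invTensor
    rw [this]
  have happ : ∀ {k l : ℕ} (i : Fin k → M) (j : Fin l → M),
      Fin.append (e ∘ i) (e ∘ j) = e ∘ Fin.append i j := by
    intro k l i j
    funext a
    refine Fin.addCases (fun a => ?_) (fun a => ?_) a <;> simp
  have hE : ∀ {k : ℕ} (γ : Setoid (Fin (k + 2))) (i : Fin k → M),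
      equivMap γ (fun j : Fin 2 → M => A (e ∘ j)) i = equivMap γ A (e ∘ i) := by
    intro k γ i
    refine Fintype.sum_equiv (Equiv.arrowCongr (Equiv.refl _) e) _ _ fun j => ?_
    change _ = invTensor γ (Fin.append (e ∘ i) (e ∘ j)) * A (e ∘ j)
    rw [happ, hker]
  have hI : ∀ {k : ℕ} (γ : Setoid (Fin k)) (T : NodeTensor N k),
      invMap γ (fun i : Fin k → M => T (e ∘ i)) = invMap γ T := by
    intro k γ T
    refine Fintype.sum_equiv (Equiv.arrowCongr (Equiv.refl _) e) _ _ fun j => ?_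
    change _ = invTensor γ (e ∘ j) * T (e ∘ j)
    rw [hker]
  have hF : ∀ i : Fin w.k → M,
      affineEquiv w.linF w.biasF (fun j : Fin 2 → M => A (e ∘ j)) i
        = affineEquiv w.linF w.biasF A (e ∘ i) := by
    intro i
    simp only [affineEquiv, hE, hker]
  simp only [tensorFeature, affineInv, hF]
  simp only [hI _ (fun i => ρe (affineEquiv w.linF w.biasF A i))]

/-- Squashing functions in the usual sense: non-decreasing, with limit `0` at `-∞` and `1` at `+∞`.
Continuity is not required. -/
def IsSquashing (ρ : ℝ → ℝ) : Prop :=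
  Monotone ρ ∧ Filter.Tendsto ρ Filter.atBot (nhds 0) ∧ Filter.Tendsto ρ Filter.atTop (nhds 1)

/-! For graphs of equal order `n`, take `k = n`, so that bijective multi-indices are orderings of
the nodes. On these, the equivariant layer realises any linear functional of the reordered adjacency
matrix (`exists_affineEquiv_apply_bijective`). No reordering of one matrix equals one of the other,
since the graphs are not isomorphic, so one functional separates all pairs (`exists_sum_mul_ne`). A
steep squashing function then gives different sums over the orderings (`IsSquashing.exists_sum_ne`),
and an affine output map sends these to two points where `ρi` differs. Graphs of different orders
are separated by counting nodes with `k = 1`. -/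

section TensorSums

open Classical in
theorem sum_mul_invTensor {N : Type*} {k : ℕ} (c : Setoid (Fin k) → ℝ) (i : Fin k → N) :
    ∑ γ, c γ * invTensor γ i = c (Setoid.ker i) := by
  simp [invTensor]

variable {N : Type*} [Fintype N] {k : ℕ}

theorem sum_mul_invMap (c : Setoid (Fin k) → ℝ) (T : NodeTensor N k) :
    ∑ γ, c γ * invMap γ T = ∑ i : Fin k → N, c (Setoid.ker i) * T i := by
  simp only [invMap, Finset.mul_sum]
  rw [Finset.sum_comm]
  refine Finset.sum_congr rfl fun i _ => ?_
  rw [← sum_mul_invTensor c i, Finset.sum_mul]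
  exact Finset.sum_congr rfl fun γ _ => by ring

theorem sum_mul_equivMap {l : ℕ} (θ : Setoid (Fin (k + l)) → ℝ) (T : NodeTensor N l)
    (i : Fin k → N) :
    ∑ γ, θ γ * equivMap γ T i = ∑ j : Fin l → N, θ (Setoid.ker (Fin.append i j)) * T j := by
  simp only [equivMap, Finset.mul_sum]
  rw [Finset.sum_comm]
  refine Finset.sum_congr rfl fun j _ => ?_
  rw [← sum_mul_invTensor θ (Fin.append i j), Finset.sum_mul]
  exact Finset.sum_congr rfl fun γ _ => by ring

theorem affineEquiv_apply {l : ℕ} (θ : Setoid (Fin (k + l)) → ℝ) (b : Setoid (Fin k) → ℝ)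
    (T : NodeTensor N l) (i : Fin k → N) :
    affineEquiv θ b T i
      = ∑ j : Fin l → N, θ (Setoid.ker (Fin.append i j)) * T j + b (Setoid.ker i) := by
  rw [affineEquiv, sum_mul_equivMap, sum_mul_invTensor]

theorem affineInv_apply (η : Setoid (Fin k) → ℝ) (b : ℝ) (T : NodeTensor N k) :
    affineInv η b T = ∑ i : Fin k → N, η (Setoid.ker i) * T i + b := by
  rw [affineInv, sum_mul_invMap]

/-- The block of the position `n + b` contains exactly one of the first `n` positions, namely `p b`.
-/
theorem ker_append_id_injective (n l : ℕ) :
    Function.Injective fun p : Fin l → Fin n => Setoid.ker (Fin.append id p) := by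
  intro p q h
  funext b
  have hp : Setoid.ker (Fin.append id p) (Fin.natAdd n b) (Fin.castAdd l (p b)) := by
    simp [Setoid.ker_def]
  have h' : Setoid.ker (Fin.append id p) = Setoid.ker (Fin.append id q) := h
  rw [h'] at hp
  simpa [Setoid.ker_def, eq_comm] using hp

/-- On bijective multi-indices, the linear equivariant maps realise every linear functional of the
relabelled tensor. -/
theorem exists_affineEquiv_apply_bijective (n l : ℕ) (Θ : (Fin l → Fin n) → ℝ) :
    ∃ θ : Setoid (Fin (n + l)) → ℝ, ∀ (N : Type) [Fintype N] (b : ℝ) (T : NodeTensor N l)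
      (i : Fin n → N), Function.Bijective i →
      affineEquiv θ (fun _ => b) T i = ∑ p : Fin l → Fin n, Θ p * T (i ∘ p) + b := by
  -- For bijective `i`, each `j` is `i ∘ p` for a unique `p`, and `(i, j)` has the equality pattern
  -- of `(id, p)`. The default `0` is thus never used.
  refine ⟨Function.extend (fun p : Fin l → Fin n => Setoid.ker (Fin.append id p)) Θ
    fun _ => 0,
    fun N _ b T i hi => ?_⟩
  rw [affineEquiv_apply]
  congr 1
  symm
  refine Fintype.sum_equiv (Equiv.arrowCongr (Equiv.refl _) (Equiv.ofBijective i hi)) _ _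
    fun p => ?_
  change Θ p * T (i ∘ p) = _ * T (i ∘ p)
  congr 1
  have hker : Setoid.ker (Fin.append i (i ∘ p)) = Setoid.ker (Fin.append id p) := by
    have : Fin.append i (i ∘ p) = i ∘ Fin.append id p := by
      funext a
      refine Fin.addCases (fun a => ?_) (fun a => ?_) a <;> simp
    rw [this]
    ext a b
    simp [Setoid.ker_def, hi.1.eq_iff]
  change Θ p = Function.extend _ Θ (fun _ => 0) (Setoid.ker (Fin.append i (i ∘ p)))
  rw [hker, (ker_append_id_injective n l).extend_apply]

end TensorSums

theorem IsSquashing.nonneg {ρ : ℝ → ℝ} (hρ : IsSquashing ρ) (x : ℝ) : 0 ≤ ρ x :=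
  hρ.1.le_of_tendsto hρ.2.1 x

/-- If a value of `f` exceeds all values of `g`, a steep rescaling of a squashing function
separates the two families by their sums. -/
theorem IsSquashing.exists_sum_ne_of_forall_lt {ρ : ℝ → ℝ} (hρ : IsSquashing ρ) {ι κ : Type*}
    [Fintype ι] [Fintype κ] (f : ι → ℝ) (g : κ → ℝ) (i : ι) (hi : ∀ j, g j < f i) :
    ∃ s t : ℝ, ∑ i, ρ (s * f i + t) ≠ ∑ j, ρ (s * g j + t) := by
  obtain ⟨c, hgc, hc⟩ : ∃ c, (∀ j, g j < c) ∧ c < f i := by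
    obtain h | h := isEmpty_or_nonempty κ
    · exact ⟨f i - 1, fun j => h.elim j, by linarith⟩
    · obtain ⟨m, hm⟩ := Finite.exists_max g
      obtain ⟨c, h₁, h₂⟩ := exists_between (hi m)
      exact ⟨c, fun j => (hm j).trans_lt h₁, h₂⟩
  -- Take `t = -s * c` and let `s → ∞`: the sum over `f` keeps a term tending to `1`, while the sum
  -- over `g` tends to `0`.
  by_contra! heq
  have hle : ∀ s : ℝ, ρ (s * (f i - c)) ≤ ∑ j, ρ (s * (g j - c)) := by
    intro s
    have h := heq s (-(s * c))
    simp only [← sub_eq_add_neg, ← mul_sub] at h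
    rw [← h]
    exact Finset.single_le_sum (f := fun i => ρ (s * (f i - c))) (fun _ _ => hρ.nonneg _)
      (Finset.mem_univ i)
  have hf : Filter.Tendsto (fun s : ℝ => ρ (s * (f i - c))) Filter.atTop (nhds 1) :=
    hρ.2.2.comp (Filter.tendsto_id.atTop_mul_const (sub_pos.2 hc))
  have hg : Filter.Tendsto (fun s : ℝ => ∑ j, ρ (s * (g j - c))) Filter.atTop
      (nhds (∑ _j : κ, 0)) :=
    tendsto_finsetSum _ fun j _ =>
      hρ.2.1.comp (Filter.tendsto_id.atTop_mul_const_of_neg (sub_neg.2 (hgc j)))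
  have := le_of_tendsto_of_tendsto' hf hg hle
  simp only [Finset.sum_const_zero] at this
  linarith

/-- The two maxima differ, and the larger one exceeds the whole other family. -/
theorem IsSquashing.exists_sum_ne {ρ : ℝ → ℝ} (hρ : IsSquashing ρ) {ι κ : Type*}
    [Fintype ι] [Fintype κ] [Nonempty ι] [Nonempty κ] (f : ι → ℝ) (g : κ → ℝ)
    (hfg : ∀ i j, f i ≠ g j) :
    ∃ s t : ℝ, ∑ i, ρ (s * f i + t) ≠ ∑ j, ρ (s * g j + t) := by
  obtain ⟨i, hi⟩ := Finite.exists_max f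
  obtain ⟨j, hj⟩ := Finite.exists_max g
  rcases lt_or_gt_of_ne (hfg i j) with h | h
  · obtain ⟨s, t, hst⟩ := hρ.exists_sum_ne_of_forall_lt g f j fun i' => (hi i').trans_lt h
    exact ⟨s, t, hst.symm⟩
  · exact hρ.exists_sum_ne_of_forall_lt f g i fun j' => (hj j').trans_lt h

/-- Some linear functional, given by coefficients, separates two finite disjoint families. -/
theorem exists_sum_mul_ne {P : Type*} [Fintype P] {ι κ : Type*} [Finite ι] [Finite κ]
    (x : ι → P → ℝ) (y : κ → P → ℝ) (hxy : ∀ i j, x i ≠ y j) :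
    ∃ Θ : P → ℝ, ∀ i j, ∑ p, Θ p * x i p ≠ ∑ p, Θ p * y j p := by
  classical
  -- Finitely many nonzero differences: finitely many proper subspaces cannot cover the dual space
  -- over an infinite field.
  obtain ⟨L, hL⟩ := Module.exists_dual_forall_apply_ne_zero (K := ℝ)
    (fun ij : ι × κ => x ij.1 - y ij.2) fun ij => sub_ne_zero.2 (hxy ij.1 ij.2)
  refine ⟨fun p => L (Pi.single p 1), fun i j h => hL (i, j) ?_⟩
  have hsum : ∀ z : P → ℝ, L z = ∑ p, L (Pi.single p 1) * z p := by
    intro z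
    conv_lhs => rw [pi_eq_sum_univ' z]
    simp [mul_comm]
  rw [map_sub, hsum, hsum (y j), h, sub_self]

namespace AttrGraph

/-- Nonzero edge attributes make the edge set recoverable from the matrix. -/
theorem adj_ne_zero_iff (g : AttrGraph) {u v : g.V} (h : u ≠ v) :
    g.adj ![u, v] ≠ 0 ↔ (u, v) ∈ g.E := by
  by_cases hE : (u, v) ∈ g.E
  · simpa [adj, h, hE] using g.edgeAttr_ne_zero ⟨(u, v), hE⟩
  · simp [adj, h, hE]

theorem isomorphic_of_adj_eq {g₁ g₂ : AttrGraph} (φ : g₁.V ≃ g₂.V)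
    (h : ∀ u v, g₁.adj ![u, v] = g₂.adj ![φ u, φ v]) : g₁.Isomorphic g₂ := by
  refine ⟨φ, fun u v => ?_, fun v => by simpa [adj] using h v v, fun u v h₁ h₂ => ?_⟩
  · by_cases huv : u = v
    · subst huv
      exact iff_of_false (g₁.loopless u) (g₂.loopless _)
    · rw [← adj_ne_zero_iff g₁ huv, ← adj_ne_zero_iff g₂ (φ.injective.ne huv), h]
  · have huv : u ≠ v := by
      rintro rfl
      exact g₁.loopless u h₁
    simpa [adj, huv, h₁, h₂] using h u v

/-- Otherwise `j ∘ i⁻¹` would be an isomorphism. -/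
theorem adj_comp_ne {g₁ g₂ : AttrGraph} (hne : ¬ g₁.Isomorphic g₂) {n : ℕ} {i : Fin n → g₁.V}
    {j : Fin n → g₂.V} (hi : Function.Bijective i) (hj : Function.Bijective j) :
    (fun p : Fin 2 → Fin n => g₁.adj (i ∘ p)) ≠ fun p => g₂.adj (j ∘ p) := by
  intro h
  refine hne (isomorphic_of_adj_eq
    ((Equiv.ofBijective i hi).symm.trans (Equiv.ofBijective j hj)) fun u v => ?_)
  have hcomp : ∀ {N : Type} (f : Fin n → N) (a b : Fin n), f ∘ ![a, b] = ![f a, f b] :=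
    fun f a b => funext fun c => by fin_cases c <;> rfl
  have := congrFun h ![(Equiv.ofBijective i hi).symm u, (Equiv.ofBijective i hi).symm v]
  simpa [hcomp, Equiv.ofBijective_apply_symm_apply] using this

end AttrGraph

/-- It suffices to separate the hidden layers by their invariant linear contractions: the output
coefficients can then be rescaled to hit any two prescribed arguments of `ρi`. -/
theorem exists_graphFeature_ne {ρi ρe : ℝ → ℝ} (hρi : ∃ x y : ℝ, ρi x ≠ ρi y) {g₁ g₂ : AttrGraph}
    {k : ℕ} (hk : 1 ≤ k) (θ : Setoid (Fin (k + 2)) → ℝ) (b η : Setoid (Fin k) → ℝ)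
    (h : ∑ i, η (Setoid.ker i) * ρe (affineEquiv θ b g₁.adj i)
      ≠ ∑ i, η (Setoid.ker i) * ρe (affineEquiv θ b g₂.adj i)) :
    ∃ w : FeatureParam, graphFeature ρi ρe w g₁ ≠ graphFeature ρi ρe w g₂ := by
  obtain ⟨x, y, hxy⟩ := hρi
  set S₁ := ∑ i, η (Setoid.ker i) * ρe (affineEquiv θ b g₁.adj i) with hS₁
  set S₂ := ∑ i, η (Setoid.ker i) * ρe (affineEquiv θ b g₂.adj i) with hS₂
  have hS : S₁ - S₂ ≠ 0 := sub_ne_zero.2 h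
  -- The slope of the affine map with `S₁ ↦ x` and `S₂ ↦ y`.
  set a := (x - y) / (S₁ - S₂) with ha
  refine ⟨⟨k, hk, θ, b, fun γ => a * η γ, x - a * S₁⟩, ?_⟩
  simp only [graphFeature, tensorFeature, affineInv_apply, mul_assoc, ← Finset.mul_sum]
  rw [← hS₁, ← hS₂]
  have h₁ : a * S₁ + (x - a * S₁) = x := by ring
  have h₂ : a * S₂ + (x - a * S₁) = y := by
    have : a * (S₁ - S₂) = x - y := div_mul_cancel₀ _ hS
    linarith
  rwa [h₁, h₂]

theorem exists_graphFeature_ne_of_card_ne {ρi ρe : ℝ → ℝ} (hρe : IsSquashing ρe)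
    (hρi : ∃ x y : ℝ, ρi x ≠ ρi y) {g₁ g₂ : AttrGraph} (hcard : g₁.V.card ≠ g₂.V.card) :
    ∃ w : FeatureParam, graphFeature ρi ρe w g₁ ≠ graphFeature ρi ρe w g₂ := by
  obtain ⟨c, hc⟩ : ∃ c, 0 < ρe c := (hρe.2.2.eventually_const_lt zero_lt_one).exists
  -- The hidden layer is constantly `ρe c`, so its sum is the order times `ρe c`.
  refine exists_graphFeature_ne hρi le_rfl 0 (fun _ => c) 1 ?_
  simp only [affineEquiv_apply]
  simpa [hc.ne'] using hcard

open Classical in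
theorem exists_graphFeature_ne_of_card_eq {ρi ρe : ℝ → ℝ} (hρe : IsSquashing ρe)
    (hρi : ∃ x y : ℝ, ρi x ≠ ρi y) {g₁ g₂ : AttrGraph} (hcard : g₁.V.card = g₂.V.card)
    (hpos : 1 ≤ g₁.V.card) (hne : ¬ AttrGraph.Isomorphic g₁ g₂) :
    ∃ w : FeatureParam, graphFeature ρi ρe w g₁ ≠ graphFeature ρi ρe w g₂ := by
  obtain ⟨n, hn₁⟩ : ∃ n, g₁.V.card = n := ⟨_, rfl⟩
  have hn₂ : g₂.V.card = n := hcard ▸ hn₁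
  have e₁ : Nonempty {i : Fin n → g₁.V // Function.Bijective i} :=
    ⟨⟨_, (g₁.V.equivFinOfCardEq hn₁).symm.bijective⟩⟩
  have e₂ : Nonempty {i : Fin n → g₂.V // Function.Bijective i} :=
    ⟨⟨_, (g₂.V.equivFinOfCardEq hn₂).symm.bijective⟩⟩
  obtain ⟨Θ, hΘ⟩ := exists_sum_mul_ne
    (fun (i : {i : Fin n → g₁.V // Function.Bijective i}) (p : Fin 2 → Fin n) => g₁.adj (i.1 ∘ p))
    (fun (j : {j : Fin n → g₂.V // Function.Bijective j}) (p : Fin 2 → Fin n) => g₂.adj (j.1 ∘ p))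
    fun i j => AttrGraph.adj_comp_ne hne i.2 j.2
  obtain ⟨s, t, hst⟩ := hρe.exists_sum_ne _ _ hΘ
  obtain ⟨θ, hθ⟩ := exists_affineEquiv_apply_bijective n 2 fun p => s * Θ p
  -- Kernel `⊥` means injective, hence bijective as both graphs have `n` nodes.
  refine exists_graphFeature_ne hρi (hn₁ ▸ hpos) θ (fun _ => t) (fun γ => if γ = ⊥ then 1 else 0) ?_
  have key : ∀ g : AttrGraph, g.V.card = n →
      ∑ i, (if Setoid.ker i = ⊥ then (1 : ℝ) else 0) * ρe (affineEquiv θ (fun _ => t) g.adj i)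
        = ∑ i : {i : Fin n → g.V // Function.Bijective i},
          ρe (s * ∑ p, Θ p * g.adj (i.1 ∘ p) + t) := by
    intro g hg
    have hbij : ∀ i : Fin n → g.V, Setoid.ker i = ⊥ ↔ Function.Bijective i := fun i => by
      rw [← Setoid.injective_iff_ker_bot, Fintype.bijective_iff_injective_and_card]
      simp [hg]
    simp only [hbij, ite_mul, one_mul, zero_mul]
    rw [← Finset.sum_filter, Finset.sum_subtype _ (p := Function.Bijective) (by simp)]
    refine Finset.sum_congr rfl fun i _ => ?_
    rw [hθ _ _ _ _ i.2, Finset.mul_sum]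
    simp only [mul_assoc]
  rw [key g₁ hn₁, key g₂ hn₂]
  exact hst

theorem lemma1 (ρi ρe : ℝ → ℝ) (hρe : IsSquashing ρe) (hρi : ∃ x y : ℝ, ρi x ≠ ρi y)
    (g₁ g₂ : AttrGraph) (hg₁ : g₁ ∈ AttrGraph.all) (hg₂ : g₂ ∈ AttrGraph.all)
    (hne : ¬ AttrGraph.Isomorphic g₁ g₂) :
    ∃ w : FeatureParam, graphFeature ρi ρe w g₁ ≠ graphFeature ρi ρe w g₂ := by
  by_cases hcard : g₁.V.card = g₂.V.card
  · refine exists_graphFeature_ne_of_card_eq hρe hρi hcard ?_ hne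
    -- Order `0` would violate `k ≥ 1`, but two empty graphs are isomorphic.
    by_contra hlt
    have h₁ : g₁.V = ∅ := Finset.card_eq_zero.1 (by omega)
    have h₂ : g₂.V = ∅ := Finset.card_eq_zero.1 (by omega)
    have : IsEmpty g₁.V := by rw [h₁]; infer_instance
    have : IsEmpty g₂.V := by rw [h₂]; infer_instance
    exact hne (AttrGraph.isomorphic_of_adj_eq (Equiv.equivOfIsEmpty _ _) fun u => isEmptyElim u)
  · exact exists_graphFeature_ne_of_card_ne hρe hρi hcard
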